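/- Let modal formulas be built from countably many propositional letters by $\bot$, $\to$ and boxes $\Box_1,\dots,\Box_N$ (with the other connectives and $\Diamond_i=\neg\Box_i\neg$ as abbreviations). A normal modal logic is a set of formulas that contains all classical tautologies and all $\Box_i(p\to q)\to(\Box_i p\to\Box_i q)$ and is closed under substitution, modus ponens and necessitation. Let $\mathsf{K}_N$ be the smallest normal modal logic with $N$ boxes, $\mathsf K=\mathsf K_1$, and let $\Lambda+\Gamma$ be the smallest normal modal logic containing $\Lambda\cup\Gamma$. The fusion of unimodal logics $\Lambda_1,\Lambda_2$ is the bimodal logic $\Lambda_1\ast\Lambda_2=\mathsf{K}_2+\Lambda_1'+\Lambda_2'$, where $\Lambda_i'$ is $\Lambda_i$ with every $\Box$ replaced by $\Box_i$. Put $\mathsf{S4}=\mathsf{K}+(\Box p\to p)+(\Box p\to\Box\Box p)$, $\mathsf{S4.1}=\mathsf{S4}+(\Box\Diamond p\to\Diamond\Box p)$, and $$\mathsf{L}=\mathsf{S4.1}\ast\mathsf{S4}+\Diamond_1\Box_2(\Diamond_1 p\to\Box_1 p).$$ Theorem. The logic $\mathsf{L}$ is finitely axiomatizable (that is, $\mathsf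 L=\mathsf K_2+\Gamma$ for some finite set $\Gamma$ of formulas), it has the finite model property (that is, $\mathsf{L}$ is the set of all formulas valid in every frame of some class of finite Kripke frames $(W,R_1,R_2)$, $W\neq\varnothing$), and it is decidable (that is, there is an algorithm that decides whether a given bimodal formula belongs to $\mathsf{L}$). -/

import Mathlib

namespace Modal

universe u

/-- Modal formulas with `N` boxes over the countably infinite set of letters `ℕ`. -/
inductive Formula (N : ℕ) : Type
  | var : ℕ → Formula N
  | bot : Formula N
  | imp : Formula N → Formula N → Formula N
  | box : Fin N → Formula N → Formula N

namespace Formula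

variable {N : ℕ}

/-- Negation, as the abbreviation `A → ⊥`. -/
def neg (A : Formula N) : Formula N := imp A bot

/-- The diamond, as the abbreviation `¬ □ᵢ ¬ A`. -/
def dia (i : Fin N) (A : Formula N) : Formula N := neg (box i (neg A))

/-- Uniform substitution of formulas for letters. -/
def subst (σ : ℕ → Formula N) : Formula N → Formula N
  | var p => σ p
  | bot => bot
  | imp A B => imp (A.subst σ) (B.subst σ)
  | box i A => box i (A.subst σ)

/-- Classical truth value under an assignment `v` of truth values to the letters and to the boxed
formulas (which are treated as atoms). -/
def classicalTruth (v : Formula N → Prop) : Formula N → Prop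
  | var p => v (var p)
  | bot => False
  | imp A B => A.classicalTruth v → B.classicalTruth v
  | box i A => v (box i A)

/-- Classical tautologies, including their modal instances. -/
def IsTautology (A : Formula N) : Prop := ∀ v : Formula N → Prop, A.classicalTruth v

/-- Replace the only box of a unimodal formula by `□ᵢ`. -/
def relabel (i : Fin N) : Formula 1 → Formula N
  | var p => var p
  | bot => bot
  | imp A B => imp (A.relabel i) (B.relabel i)
  | box _ A => box i (A.relabel i)

/-- A Gödel numbering of the modal formulas. -/
def code : Formula N → ℕ
  | bot => 0
  | var p => 3 * p + 1
  | imp A B => 3 * Nat.pair A.code B.code + 2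
  | box i A => 3 * (N * A.code + i) + 3

theorem code_injective : Function.Injective (code : Formula N → ℕ) := by
  intro A
  induction A with
  | var p =>
    intro B h
    cases B <;> simp only [code] at h
    · congr 1; omega
    all_goals omega
  | bot =>
    intro B h
    cases B <;> simp only [code] at h
    · omega
    · rfl
    all_goals omega
  | imp A₁ A₂ ih₁ ih₂ =>
    intro B h
    cases B <;> simp only [code] at h
    · omega
    · omega
    · have h2 := Nat.pair_eq_pair.1 (Nat.eq_of_mul_eq_mul_left (show 0 < 3 by norm_num)
        (Nat.add_right_cancel h))
      rw [ih₁ h2.1, ih₂ h2.2]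
    · omega
  | box i A ih =>
    intro B h
    cases B with
    | var p => simp only [code] at h; omega
    | bot => simp only [code] at h; omega
    | imp B₁ B₂ => simp only [code] at h; omega
    | box j B =>
      simp only [code] at h
      have h2 : N * A.code + (i : ℕ) = N * B.code + (j : ℕ) := by omega
      have hN : 0 < N := i.pos
      have hd := congrArg (· / N) h2
      have hm := congrArg (· % N) h2
      simp only [Nat.mul_add_div hN, Nat.div_eq_of_lt i.isLt, Nat.div_eq_of_lt j.isLt,
        Nat.mul_add_mod, Nat.mod_eq_of_lt i.isLt, Nat.mod_eq_of_lt j.isLt, add_zero] at hd hm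
      rw [ih hd, Fin.ext hm]

end Formula

open Formula

/-- Normal modal logics. -/
structure IsNormalLogic {N : ℕ} (L : Set (Formula N)) : Prop where
  taut : ∀ A : Formula N, A.IsTautology → A ∈ L
  normality : ∀ i : Fin N,
    imp (box i (imp (var 0) (var 1))) (imp (box i (var 0)) (box i (var 1))) ∈ L
  subst : ∀ (σ : ℕ → Formula N) (A : Formula N), A ∈ L → A.subst σ ∈ L
  mp : ∀ A B : Formula N, A ∈ L → imp A B ∈ L → B ∈ L
  nec : ∀ (i : Fin N) (A : Formula N), A ∈ L → box i A ∈ L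

/-- The smallest normal modal logic with `N` modalities. -/
def logicK (N : ℕ) : Set (Formula N) := ⋂₀ {L | IsNormalLogic L}

/-- `L + Γ`: the smallest normal modal logic that contains `L` and `Γ`. -/
def addAxioms {N : ℕ} (L Γ : Set (Formula N)) : Set (Formula N) :=
  ⋂₀ {L' | IsNormalLogic L' ∧ L ⊆ L' ∧ Γ ⊆ L'}

/-- The fusion of two unimodal logics. -/
def fusion (L₁ L₂ : Set (Formula 1)) : Set (Formula 2) :=
  addAxioms (addAxioms (logicK 2) (relabel 0 '' L₁)) (relabel 1 '' L₂)

/-- `S4 = K + □p → p + □p → □□p`. -/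
def logicS4 : Set (Formula 1) :=
  addAxioms (addAxioms (logicK 1) {imp (box 0 (var 0)) (var 0)})
    {imp (box 0 (var 0)) (box 0 (box 0 (var 0)))}

/-- `S4.1 = S4 + □◇p → ◇□p`. -/
def logicS41 : Set (Formula 1) :=
  addAxioms logicS4 {imp (box 0 (dia 0 (var 0))) (dia 0 (box 0 (var 0)))}

/-- `L = S4.1 ∗ S4 + ◇₁□₂(◇₁p → □₁p)`; the indices `1, 2` of the modalities are `0, 1 : Fin 2`. -/
def logicL : Set (Formula 2) :=
  addAxioms (fusion logicS41 logicS4)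
    {dia 0 (box 1 (imp (dia 0 (var 0)) (box 0 (var 0))))}

/-- Kripke `N`-frames. -/
structure KripkeFrame (N : ℕ) where
  World : Type u
  nonempty : Nonempty World
  R : Fin N → World → World → Prop

/-- Truth of a formula at a point of the Kripke model `(F, V)`. -/
def KripkeFrame.Sat {N : ℕ} (F : KripkeFrame.{u} N) (V : ℕ → Set F.World) :
    F.World → Formula N → Prop
  | x, var p => x ∈ V p
  | _, bot => False
  | x, imp A B => F.Sat V x A → F.Sat V x B
  | x, box i A => ∀ y, F.R i x y → F.Sat V y A

/-- Validity of a formula in a Kripke frame. -/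
def KripkeFrame.Valid {N : ℕ} (F : KripkeFrame.{u} N) (A : Formula N) : Prop :=
  ∀ (V : ℕ → Set F.World) (x : F.World), F.Sat V x A

/-- The logic of a class of Kripke frames. -/
def logicOf {N : ℕ} (C : Set (KripkeFrame.{u} N)) : Set (Formula N) :=
  {A | ∀ F ∈ C, F.Valid A}

/-- Finite model property: being the logic of a class of finite frames. (Up to isomorphism, every
finite frame lives in the lowest universe.) -/
def HasFiniteModelProperty {N : ℕ} (L : Set (Formula N)) : Prop :=
  ∃ C : Set (KripkeFrame.{0} N), (∀ F ∈ C, Finite F.World) ∧ L = logicOf C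

/-- Finite axiomatizability (over the smallest normal modal logic). -/
def IsFinitelyAxiomatizable {N : ℕ} (L : Set (Formula N)) : Prop :=
  ∃ Γ : Set (Formula N), Γ.Finite ∧ L = addAxioms (logicK N) Γ

/-- Decidability: the set of Gödel numbers of the members of `L` is recursive. -/
def IsDecidable {N : ℕ} (L : Set (Formula N)) : Prop :=
  ComputablePred (fun n : ℕ => ∃ A ∈ L, A.code = n)

end Modal

/-!
Completeness goes through the canonical model, which for `logicL` is a model on two preorders. In
any such model the last axiom lets every point `x` reach, along `R₁`, a *stable* point for a given
finite set `S` of formulas: a point all of whose `R₂`-successors see along `R₁` only points that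
agree with them on `S`. Indeed the axiom makes every formula constant on the `R₁`-cone of
some `R₁`-successor, hence finitely many of them at once; take these to be the formulas
`□₂(◇₁B → □₁B)` with `B ∈ S`, which then are true, because the axiom makes them true somewhere in
that cone.

Now filtrate through `S` as for `S4`, but let the type of a stable point see only itself along `R₁`
and only types of stable points along `R₂`. The truth lemma survives, and in the resulting finite
frame every point sees along `R₁` a point all of whose `R₂`-successors are `R₁`-final, which
validates both the last axiom and `□₁◇₁p → ◇₁□₁p`.

The filtration has at most `2 ^ (c + 1)` points, where `c` is the code of the refuted formula.
Frames of bounded size and truth tables on them are coded by the binary digits of bounded numbers,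
so non-membership in `logicL` is a bounded search.
-/

namespace Modal

open Formula

universe v

section NormalLogics

variable {N : ℕ}

theorem isNormalLogic_sInter {S : Set (Set (Formula N))} (hS : ∀ L ∈ S, IsNormalLogic L) :
    IsNormalLogic (⋂₀ S) where
  taut A hA L hL := (hS L hL).taut A hA
  normality i L hL := (hS L hL).normality i
  subst σ A hA L hL := (hS L hL).subst σ A (hA L hL)
  mp A B hA hAB L hL := (hS L hL).mp A B (hA L hL) (hAB L hL)
  nec i A hA L hL := (hS L hL).nec i A (hA L hL)

theorem logicK_subset {L : Set (Formula N)} (hL : IsNormalLogic L) : logicK N ⊆ L :=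
  Set.sInter_subset_of_mem hL

theorem isNormalLogic_addAxioms (L Γ : Set (Formula N)) : IsNormalLogic (addAxioms L Γ) :=
  isNormalLogic_sInter fun _ h => h.1

theorem subset_addAxioms_left (L Γ : Set (Formula N)) : L ⊆ addAxioms L Γ :=
  fun _ hA _ h => h.2.1 hA

theorem subset_addAxioms_right (L Γ : Set (Formula N)) : Γ ⊆ addAxioms L Γ :=
  fun _ hA _ h => h.2.2 hA

theorem addAxioms_subset {L Γ L' : Set (Formula N)} (h : IsNormalLogic L') (hL : L ⊆ L')
    (hΓ : Γ ⊆ L') : addAxioms L Γ ⊆ L' :=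
  Set.sInter_subset_of_mem ⟨h, hL, hΓ⟩

theorem classicalTruth_relabel (i : Fin N) (v : Formula N → Prop) (A : Formula 1) :
    (A.relabel i).classicalTruth v ↔ A.classicalTruth fun B => v (B.relabel i) := by
  induction A with
  | var p => rfl
  | bot => rfl
  | imp A B ihA ihB => simp only [relabel, classicalTruth, ihA, ihB]
  | box j A _ => rfl

theorem relabel_subst (i : Fin N) (σ : ℕ → Formula 1) (A : Formula 1) :
    (A.subst σ).relabel i = (A.relabel i).subst fun p => (σ p).relabel i := by
  induction A with
  | var p => rfl
  | bot => rfl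
  | imp A B ihA ihB => simp only [relabel, Formula.subst, ihA, ihB]
  | box j A ih => simp only [relabel, Formula.subst, ih]

theorem IsNormalLogic.relabel_preimage {L : Set (Formula N)} (hL : IsNormalLogic L) (i : Fin N) :
    IsNormalLogic (relabel i ⁻¹' L) where
  taut A hA := hL.taut _ fun v => (classicalTruth_relabel i v A).2 (hA _)
  normality _ := hL.normality i
  subst σ A hA := by
    rw [Set.mem_preimage, relabel_subst]
    exact hL.subst _ _ hA
  mp _ _ hA hAB := hL.mp _ _ hA hAB
  nec _ _ hA := hL.nec i _ hA

end NormalLogics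

section Axioms

variable {N : ℕ}

/-- The axiom `□ᵢp → p`. -/
def axiomT (i : Fin N) : Formula N := imp (box i (var 0)) (var 0)

/-- The axiom `□ᵢp → □ᵢ□ᵢp`. -/
def axiomFour (i : Fin N) : Formula N := imp (box i (var 0)) (box i (box i (var 0)))

/-- The McKinsey axiom `□ᵢ◇ᵢp → ◇ᵢ□ᵢp`. -/
def axiomMcKinsey (i : Fin N) : Formula N := imp (box i (dia i (var 0))) (dia i (box i (var 0)))

/-- The formula `◇ᵢA → □ᵢA`, which on a reflexive frame says that `A` has the same truth value at
all `Rᵢ`-successors of a point. -/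
def settled (i : Fin N) (A : Formula N) : Formula N := imp (dia i A) (box i A)

/-- The axioms from which `logicL` is built, with the unimodal ones relabelled. -/
def axiomsL : Set (Formula 2) :=
  {axiomT 0, axiomFour 0, axiomMcKinsey 0, axiomT 1, axiomFour 1,
    dia 0 (box 1 (settled 0 (var 0)))}

theorem logicS4_subset_iff {L : Set (Formula 1)} (hL : IsNormalLogic L) :
    logicS4 ⊆ L ↔ axiomT 0 ∈ L ∧ axiomFour 0 ∈ L := by
  refine ⟨fun h => ⟨h (subset_addAxioms_left _ _ (subset_addAxioms_right _ _ rfl)),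
    h (subset_addAxioms_right _ _ rfl)⟩, fun ⟨hT, hFour⟩ => ?_⟩
  exact addAxioms_subset hL
    (addAxioms_subset hL (logicK_subset hL) (Set.singleton_subset_iff.2 hT))
    (Set.singleton_subset_iff.2 hFour)

theorem logicS41_subset_iff {L : Set (Formula 1)} (hL : IsNormalLogic L) :
    logicS41 ⊆ L ↔ axiomT 0 ∈ L ∧ axiomFour 0 ∈ L ∧ axiomMcKinsey 0 ∈ L := by
  rw [← and_assoc, ← logicS4_subset_iff hL]
  exact ⟨fun h => ⟨(subset_addAxioms_left _ _).trans h, h (subset_addAxioms_right _ _ rfl)⟩,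
    fun h => addAxioms_subset hL h.1 (Set.singleton_subset_iff.2 h.2)⟩

theorem fusion_subset_iff {L₁ L₂ : Set (Formula 1)} {L : Set (Formula 2)} (hL : IsNormalLogic L) :
    fusion L₁ L₂ ⊆ L ↔ L₁ ⊆ relabel 0 ⁻¹' L ∧ L₂ ⊆ relabel 1 ⁻¹' L := by
  rw [← Set.image_subset_iff, ← Set.image_subset_iff]
  refine ⟨fun h => ⟨((subset_addAxioms_right _ _).trans (subset_addAxioms_left _ _)).trans h,
    (subset_addAxioms_right _ _).trans h⟩, fun ⟨h₁, h₂⟩ => ?_⟩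
  exact addAxioms_subset hL (addAxioms_subset hL (logicK_subset hL) h₁) h₂

theorem logicL_subset_iff {L : Set (Formula 2)} (hL : IsNormalLogic L) :
    logicL ⊆ L ↔ axiomsL ⊆ L := by
  have hfusion : fusion logicS41 logicS4 ⊆ L ↔
      (axiomT 0 ∈ L ∧ axiomFour 0 ∈ L ∧ axiomMcKinsey 0 ∈ L) ∧ axiomT 1 ∈ L ∧ axiomFour 1 ∈ L :=
    (fusion_subset_iff hL).trans (and_congr (logicS41_subset_iff (hL.relabel_preimage 0))
      (logicS4_subset_iff (hL.relabel_preimage 1)))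
  have hsum : logicL ⊆ L ↔
      fusion logicS41 logicS4 ⊆ L ∧ dia 0 (box 1 (settled 0 (var 0))) ∈ L :=
    ⟨fun h => ⟨(subset_addAxioms_left _ _).trans h, h (subset_addAxioms_right _ _ rfl)⟩,
      fun h => addAxioms_subset hL h.1 (Set.singleton_subset_iff.2 h.2)⟩
  rw [hsum, hfusion]
  simp only [axiomsL, Set.insert_subset_iff, Set.singleton_subset_iff, and_assoc]

theorem isNormalLogic_logicL : IsNormalLogic logicL := isNormalLogic_addAxioms _ _

theorem axiomsL_subset_logicL : axiomsL ⊆ logicL :=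
  (logicL_subset_iff isNormalLogic_logicL).1 subset_rfl

theorem isFinitelyAxiomatizable_logicL : IsFinitelyAxiomatizable logicL := by
  refine ⟨axiomsL, by simp [axiomsL], Set.Subset.antisymm ?_ ?_⟩
  · exact (logicL_subset_iff (isNormalLogic_addAxioms _ _)).2 (subset_addAxioms_right _ _)
  · exact addAxioms_subset isNormalLogic_logicL (logicK_subset isNormalLogic_logicL)
      axiomsL_subset_logicL

end Axioms

section Validity

variable {N : ℕ} (F : KripkeFrame.{u} N) (V : ℕ → Set F.World)

theorem KripkeFrame.classicalTruth_sat (x : F.World) (A : Formula N) :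
    A.classicalTruth (F.Sat V x) ↔ F.Sat V x A := by
  induction A with
  | var p => rfl
  | bot => rfl
  | imp A B ihA ihB => simp only [classicalTruth, KripkeFrame.Sat, ihA, ihB]
  | box j A _ => rfl

theorem KripkeFrame.sat_subst (σ : ℕ → Formula N) (A : Formula N) (x : F.World) :
    F.Sat V x (A.subst σ) ↔ F.Sat (fun p => {y | F.Sat V y (σ p)}) x A := by
  induction A generalizing x with
  | var p => rfl
  | bot => rfl
  | imp A B ihA ihB => simp only [Formula.subst, KripkeFrame.Sat, ihA, ihB]
  | box j A ih => simp only [Formula.subst, KripkeFrame.Sat, ih]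

theorem KripkeFrame.isNormalLogic_valid : IsNormalLogic {A | F.Valid A} where
  taut A hA V x := (F.classicalTruth_sat V x A).1 (hA _)
  normality _ _ _ h h0 y hy := h y hy (h0 y hy)
  subst σ A hA V x := (F.sat_subst V σ A x).2 (hA _ x)
  mp _ _ hA hAB V x := hAB V x (hA V x)
  nec _ _ hA V _ y _ := hA V y

variable {F V}

theorem KripkeFrame.sat_dia_iff {i : Fin N} {x : F.World} {A : Formula N} :
    F.Sat V x (dia i A) ↔ ∃ y, F.R i x y ∧ F.Sat V y A := by
  simp only [dia, neg, KripkeFrame.Sat, not_forall, exists_prop, imp_false, not_not]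

/-- `P` has the same truth value at all `R`-successors of `x` as at `x`. -/
def IsSettledAt {α : Type*} (R : α → α → Prop) (P : α → Prop) (x : α) : Prop :=
  ∀ y, R x y → (P y ↔ P x)

theorem KripkeFrame.sat_settled_iff {i : Fin N} {x : F.World} (hx : F.R i x x) {A : Formula N} :
    F.Sat V x (settled i A) ↔ IsSettledAt (F.R i) (F.Sat V · A) x := by
  refine Iff.trans (imp_congr KripkeFrame.sat_dia_iff Iff.rfl)
    ⟨fun h y hxy => ⟨fun hy => h ⟨y, hxy, hy⟩ x hx, fun hA => h ⟨x, hx, hA⟩ y hxy⟩, ?_⟩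
  rintro h ⟨y, hxy, hy⟩ z hxz
  exact (h z hxz).2 ((h y hxy).1 hy)

theorem KripkeFrame.sat_dia_box_settled_iff {i j : Fin N} (hi : ∀ x, F.R i x x) {x : F.World}
    {A : Formula N} :
    F.Sat V x (dia i (box j (settled i A))) ↔
      ∃ y, F.R i x y ∧ ∀ z, F.R j y z → IsSettledAt (F.R i) (F.Sat V · A) z :=
  KripkeFrame.sat_dia_iff.trans <| exists_congr fun _ => and_congr_right fun _ =>
    forall₂_congr fun z _ => KripkeFrame.sat_settled_iff (hi z)

end Validity

section LFrames

/-- Frames for `logicL`: both relations are preorders, and every point sees along `R 0` a point all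
of whose `R 1`-successors see only themselves along `R 0`. Not every frame that validates `logicL`
is of this kind, but `logicL` turns out to be complete for the finite ones that are. -/
structure KripkeFrame.IsLFrame (F : KripkeFrame.{u} 2) : Prop where
  refl : ∀ i x, F.R i x x
  trans : ∀ i x y z, F.R i x y → F.R i y z → F.R i x z
  exists_final : ∀ x, ∃ y, F.R 0 x y ∧ ∀ z, F.R 1 y z → ∀ w, F.R 0 z w → w = z

theorem KripkeFrame.IsLFrame.logicL_subset_valid {F : KripkeFrame.{u} 2} (hF : F.IsLFrame) :
    logicL ⊆ {A | F.Valid A} := by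
  have valid_T (i : Fin 2) : F.Valid (axiomT i) := fun V x h => h x (hF.refl i x)
  have valid_four (i : Fin 2) : F.Valid (axiomFour i) := fun V x h y hxy z hyz =>
    h z (hF.trans i x y z hxy hyz)
  have valid_mcKinsey : F.Valid (axiomMcKinsey 0) := fun V x h => by
    obtain ⟨y, hxy, hfinal⟩ := hF.exists_final x
    obtain ⟨z, hyz, hz⟩ := sat_dia_iff.1 (h y hxy)
    refine sat_dia_iff.2 ⟨y, hxy, fun w hyw => ?_⟩
    have eq_of_rel := hfinal y (hF.refl 1 y)
    rwa [eq_of_rel w hyw, ← eq_of_rel z hyz]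
  have valid_mix : F.Valid (dia 0 (box 1 (settled 0 (var 0)))) := fun V x => by
    obtain ⟨y, hxy, hfinal⟩ := hF.exists_final x
    refine (sat_dia_box_settled_iff (hF.refl 0)).2 ⟨y, hxy, fun z hyz w hzw => ?_⟩
    rw [hfinal z hyz w hzw]
  refine (logicL_subset_iff F.isNormalLogic_valid).2 ?_
  simp only [axiomsL, Set.insert_subset_iff, Set.singleton_subset_iff]
  exact ⟨valid_T 0, valid_four 0, valid_mcKinsey, valid_T 1, valid_four 1, valid_mix⟩

end LFrames

section Theories

variable {N : ℕ} {L T : Set (Formula N)}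

/-- The theories over `L`: sets of formulas that contain `L` and are closed under modus ponens. -/
structure IsTheory (L T : Set (Formula N)) : Prop where
  subset : L ⊆ T
  mp : ∀ {A B : Formula N}, A ∈ T → imp A B ∈ T → B ∈ T

theorem IsTheory.taut_mem (hL : IsNormalLogic L) (hT : IsTheory L T) {A : Formula N}
    (hA : A.IsTautology) : A ∈ T :=
  hT.subset (hL.taut A hA)

theorem IsTheory.subset_conditional (hL : IsNormalLogic L) (hT : IsTheory L T) (C : Formula N) :
    T ⊆ {B | imp C B ∈ T} :=
  fun _ hB => hT.mp hB (hT.taut_mem hL fun _ h _ => h)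

theorem IsTheory.conditional (hL : IsNormalLogic L) (hT : IsTheory L T) (C : Formula N) :
    IsTheory L {B | imp C B ∈ T} where
  subset := hT.subset.trans (hT.subset_conditional hL C)
  mp {A B} hA hAB := by
    have distrib : (imp (imp C (imp A B)) (imp (imp C A) (imp C B))).IsTautology :=
      fun _ hCAB hCA hC => hCAB hC (hCA hC)
    exact hT.mp hA (hT.mp hAB (hT.taut_mem hL distrib))

theorem IsTheory.box_preimage (hL : IsNormalLogic L) (hT : IsTheory L T) (i : Fin N) :
    IsTheory L {B | box i B ∈ T} where
  subset B hB := hT.subset (hL.nec i B hB)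
  mp {A B} hA hAB := by
    have normality : imp (box i (imp A B)) (imp (box i A) (box i B)) ∈ L :=
      hL.subst (fun n => if n = 0 then A else B) _ (hL.normality i)
    exact hT.mp hA (hT.mp hAB (hT.subset normality))

theorem IsTheory.sUnion {c : Set (Set (Formula N))} (hc : ∀ T ∈ c, IsTheory L T)
    (hchain : IsChain (· ⊆ ·) c) (hne : c.Nonempty) : IsTheory L (⋃₀ c) where
  subset := (hc _ hne.some_mem).subset.trans (Set.subset_sUnion_of_mem hne.some_mem)
  mp := by
    rintro A B ⟨T₁, hT₁, hA⟩ ⟨T₂, hT₂, hAB⟩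
    obtain ⟨T, hT, h₁, h₂⟩ := hchain.directedOn _ hT₁ _ hT₂
    exact ⟨T, hT, (hc T hT).mp (h₁ hA) (h₂ hAB)⟩

theorem IsTheory.exists_maximal (hT : IsTheory L T) {A : Formula N} (hA : A ∉ T) :
    ∃ T', T ⊆ T' ∧ Maximal (fun T' => IsTheory L T' ∧ A ∉ T') T' := by
  refine zorn_subset_nonempty {T' | IsTheory L T' ∧ A ∉ T'} (fun c hc hchain hne => ?_) T ⟨hT, hA⟩
  refine ⟨⋃₀ c, ⟨IsTheory.sUnion (fun T' hT' => (hc hT').1) hchain hne, ?_⟩,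
    fun T' => Set.subset_sUnion_of_mem⟩
  rintro ⟨T', hT', hAT'⟩
  exact (hc hT').2 hAT'

theorem imp_mem_of_maximal (hL : IsNormalLogic L) {A B : Formula N}
    (hmax : Maximal (fun T' => IsTheory L T' ∧ A ∉ T') T) (hB : B ∉ T) : imp B A ∈ T := by
  have hT := hmax.prop.1
  by_contra hBA
  have hle := hmax.le_of_ge ⟨hT.conditional hL B, hBA⟩ (hT.subset_conditional hL B)
  exact hB (hle (hT.taut_mem hL fun _ h => h))

/-- The complete theories over `L`: consistent theories that contain each formula or its negation.
They are the worlds of the canonical frame of `L`. -/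
structure CompleteTheory (L : Set (Formula N)) where
  carrier : Set (Formula N)
  isTheory : IsTheory L carrier
  bot_notMem : bot ∉ carrier
  mem_or_neg_mem : ∀ A : Formula N, A ∈ carrier ∨ neg A ∈ carrier

instance : SetLike (CompleteTheory L) (Formula N) where
  coe := CompleteTheory.carrier
  coe_injective := fun x y h => by
    cases x
    cases y
    congr

theorem IsTheory.exists_completeTheory (hL : IsNormalLogic L) (hT : IsTheory L T) {A : Formula N}
    (hA : A ∉ T) : ∃ x : CompleteTheory L, T ⊆ x ∧ A ∉ x := by
  obtain ⟨T', hTT', hmax⟩ := hT.exists_maximal hA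
  obtain ⟨hT', hAT'⟩ := hmax.prop
  refine ⟨⟨T', hT', fun hbot => hAT' (hT'.mp hbot (hT'.taut_mem hL fun _ h => h.elim)),
    fun B => ?_⟩, hTT', hAT'⟩
  by_contra! hB
  have byCases : (imp (imp B A) (imp (imp (neg B) A) A)).IsTautology :=
    fun _ hBA hnBA => (Classical.em _).elim hBA hnBA
  exact hAT' (hT'.mp (imp_mem_of_maximal hL hmax hB.2)
    (hT'.mp (imp_mem_of_maximal hL hmax hB.1) (hT'.taut_mem hL byCases)))

variable (x : CompleteTheory L)

theorem CompleteTheory.imp_mem_iff (hL : IsNormalLogic L) {A B : Formula N} :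
    imp A B ∈ x ↔ (A ∈ x → B ∈ x) := by
  refine ⟨fun h hA => x.isTheory.mp hA h, fun h => ?_⟩
  rcases x.mem_or_neg_mem A with hA | hA
  · exact x.isTheory.mp (h hA) (x.isTheory.taut_mem hL fun _ h _ => h)
  · exact x.isTheory.mp hA (x.isTheory.taut_mem hL fun _ h h' => (h h').elim)

theorem CompleteTheory.box_mem_iff (hL : IsNormalLogic L) {i : Fin N} {A : Formula N} :
    box i A ∈ x ↔ ∀ y : CompleteTheory L, (∀ B, box i B ∈ x → B ∈ y) → A ∈ y := by
  refine ⟨fun h y hxy => hxy A h, fun h => ?_⟩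
  by_contra hA
  obtain ⟨y, hxy, hAy⟩ := (x.isTheory.box_preimage hL i).exists_completeTheory hL hA
  exact hAy (h y fun B hB => hxy hB)

end Theories

section CanonicalModel

variable {N : ℕ} (L : Set (Formula N)) [Nonempty (CompleteTheory L)]

/-- The canonical frame of `L`. -/
def canonicalFrame : KripkeFrame.{0} N where
  World := CompleteTheory L
  nonempty := ‹_›
  R i x y := ∀ A, box i A ∈ x → A ∈ y

/-- The canonical valuation: a letter is true in the complete theories that contain it. -/
def canonicalValuation (p : ℕ) : Set (canonicalFrame L).World :=
  {x : CompleteTheory L | var p ∈ x}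

variable {L}

theorem sat_canonicalFrame_iff (hL : IsNormalLogic L) {A : Formula N} {x : CompleteTheory L} :
    (canonicalFrame L).Sat (canonicalValuation L) x A ↔ A ∈ x := by
  induction A generalizing x with
  | var p => rfl
  | bot => exact iff_of_false id x.bot_notMem
  | imp A B ihA ihB => exact (imp_congr ihA ihB).trans (x.imp_mem_iff hL).symm
  | box i A ih => exact (forall₂_congr fun _ _ => ih).trans (x.box_mem_iff hL).symm

theorem sat_canonicalFrame_of_mem (hL : IsNormalLogic L) {A : Formula N} (hA : A ∈ L)
    (x : CompleteTheory L) : (canonicalFrame L).Sat (canonicalValuation L) x A :=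
  (sat_canonicalFrame_iff hL).2 (x.isTheory.subset hA)

theorem canonicalFrame_refl (hL : IsNormalLogic L) {i : Fin N} (hT : axiomT i ∈ L)
    (x : CompleteTheory L) : (canonicalFrame L).R i x x :=
  fun A hA => x.isTheory.mp hA (x.isTheory.subset (hL.subst (fun _ => A) _ hT))

theorem canonicalFrame_trans (hL : IsNormalLogic L) {i : Fin N} (hFour : axiomFour i ∈ L)
    {x y z : CompleteTheory L} (hxy : (canonicalFrame L).R i x y)
    (hyz : (canonicalFrame L).R i y z) : (canonicalFrame L).R i x z :=
  fun A hA => hyz A (hxy _ (x.isTheory.mp hA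
    (x.isTheory.subset (hL.subst (fun _ => A) _ hFour))))

end CanonicalModel

section LModels

/-- Models on two preorders in which `◇₁□₂(◇₁A → □₁A)` is true everywhere, for every formula `A`. -/
structure KripkeFrame.IsLModel (F : KripkeFrame.{u} 2) (V : ℕ → Set F.World) : Prop where
  refl : ∀ i x, F.R i x x
  trans : ∀ i x y z, F.R i x y → F.R i y z → F.R i x z
  exists_settled : ∀ A x, ∃ y, F.R 0 x y ∧
    ∀ z, F.R 1 y z → IsSettledAt (F.R 0) (F.Sat V · A) z

theorem isLModel_canonicalFrame [Nonempty (CompleteTheory logicL)] :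
    (canonicalFrame logicL).IsLModel (canonicalValuation logicL) := by
  have hL := isNormalLogic_logicL
  have hax := axiomsL_subset_logicL
  simp only [axiomsL, Set.insert_subset_iff, Set.singleton_subset_iff] at hax
  obtain ⟨hT₀, hFour₀, -, hT₁, hFour₁, hmix⟩ := hax
  have refl : ∀ i x, (canonicalFrame logicL).R i x x :=
    Fin.forall_fin_two.2 ⟨canonicalFrame_refl hL hT₀, canonicalFrame_refl hL hT₁⟩
  refine ⟨refl, fun i x y z => ?_, fun A x => ?_⟩
  · match i with
    | 0 => exact canonicalFrame_trans hL hFour₀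
    | 1 => exact canonicalFrame_trans hL hFour₁
  · exact (KripkeFrame.sat_dia_box_settled_iff (refl 0)).1
      (sat_canonicalFrame_of_mem hL (hL.subst (fun _ => A) _ hmix) x)

theorem exists_isLModel_not_sat {A : Formula 2} (hA : A ∉ logicL) :
    ∃ (F : KripkeFrame.{0} 2) (V : ℕ → Set F.World) (x : F.World),
      F.IsLModel V ∧ ¬ F.Sat V x A := by
  have hL := isNormalLogic_logicL
  obtain ⟨x, -, hAx⟩ := IsTheory.exists_completeTheory hL ⟨subset_rfl, fun h => hL.mp _ _ h⟩ hA
  have : Nonempty (CompleteTheory logicL) := ⟨x⟩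
  exact ⟨_, _, x, isLModel_canonicalFrame, (sat_canonicalFrame_iff hL).not.2 hAx⟩

theorem exists_rel_forall_isSettledAt {ι α : Type*} {R : α → α → Prop} (hrefl : ∀ x, R x x)
    (htrans : ∀ x y z, R x y → R y z → R x z) {P : ι → α → Prop}
    (hP : ∀ i x, ∃ y, R x y ∧ IsSettledAt R (P i) y) {s : Set ι} (hs : s.Finite) (x : α) :
    ∃ y, R x y ∧ ∀ i ∈ s, IsSettledAt R (P i) y := by
  induction s, hs using Set.Finite.induction_on with
  | empty => exact ⟨x, hrefl x, by simp⟩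
  | @insert i s _ _ ih =>
    obtain ⟨y, hxy, hy⟩ := ih
    obtain ⟨z, hyz, hz⟩ := hP i y
    refine ⟨z, htrans x y z hxy hyz, Set.forall_mem_insert.2 ⟨hz, fun j hj w hzw => ?_⟩⟩
    exact (hy j hj w (htrans y z w hyz hzw)).trans (hy j hj z hyz).symm

variable {F : KripkeFrame.{u} 2} {V : ℕ → Set F.World} {S : Set (Formula 2)}

/-- A point is stable for a set `S` of formulas if the truth values of all members of `S` are
settled along `R 0` at all its `R 1`-successors. -/
def KripkeFrame.IsStable (F : KripkeFrame.{u} 2) (V : ℕ → Set F.World) (S : Set (Formula 2))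
    (x : F.World) : Prop :=
  ∀ A ∈ S, ∀ z, F.R 1 x z → IsSettledAt (F.R 0) (F.Sat V · A) z

theorem KripkeFrame.IsLModel.isStable_of_rel_one (hM : F.IsLModel V) {x y : F.World}
    (hx : F.IsStable V S x) (hxy : F.R 1 x y) : F.IsStable V S y :=
  fun A hA z hyz => hx A hA z (hM.trans 1 x y z hxy hyz)

theorem KripkeFrame.IsLModel.exists_isStable (hM : F.IsLModel V) (hS : S.Finite) (x : F.World) :
    ∃ y, F.R 0 x y ∧ F.IsStable V S y := by
  let boxSettled (A : Formula 2) : Formula 2 := box 1 (settled 0 A)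
  have sat_boxSettled (A : Formula 2) (y : F.World) : F.Sat V y (boxSettled A) ↔
      ∀ z, F.R 1 y z → IsSettledAt (F.R 0) (F.Sat V · A) z :=
    forall₂_congr fun z _ => sat_settled_iff (hM.refl 0 z)
  have eventually_settled (A : Formula 2) (x : F.World) :
      ∃ y, F.R 0 x y ∧ IsSettledAt (F.R 0) (F.Sat V · (boxSettled A)) y := by
    obtain ⟨y, hxy, hy⟩ := hM.exists_settled (boxSettled A) x
    exact ⟨y, hxy, hy y (hM.refl 1 y)⟩
  obtain ⟨y, hxy, hy⟩ :=
    exists_rel_forall_isSettledAt (hM.refl 0) (hM.trans 0) eventually_settled hS x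
  refine ⟨y, hxy, fun A hA => (sat_boxSettled A y).1 ?_⟩
  obtain ⟨z, hyz, hz⟩ := hM.exists_settled A y
  exact (hy A hA z hyz).1 ((sat_boxSettled A z).2 hz)

end LModels

section Filtration

/-- Closure of a set of formulas under subformulas. -/
structure IsSubformulaClosed {N : ℕ} (S : Set (Formula N)) : Prop where
  imp_left : ∀ {A B : Formula N}, imp A B ∈ S → A ∈ S
  imp_right : ∀ {A B : Formula N}, imp A B ∈ S → B ∈ S
  of_box : ∀ {i : Fin N} {A : Formula N}, box i A ∈ S → A ∈ S

/-- The type of a point: the set of the members of `S` that are true there. -/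
def KripkeFrame.typeOf {N : ℕ} (F : KripkeFrame.{u} N) (V : ℕ → Set F.World)
    (S : Set (Formula N)) (x : F.World) : Set (Formula N) :=
  {A ∈ S | F.Sat V x A}

namespace KripkeFrame

variable (F : KripkeFrame.{u} 2) (V : ℕ → Set F.World) (S : Set (Formula 2))

/-- The types of the stable points. -/
def stableTypes : Set (Set (Formula 2)) := F.typeOf V S '' {x | F.IsStable V S x}

/-- The transitive filtration of `(F, V)` through `S`, modified at the types of stable points: such
a type sees only itself along `R 0`, and only types of stable points along `R 1`. -/
def filtration : KripkeFrame.{0} 2 where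
  World := Set.range (F.typeOf V S)
  nonempty := F.nonempty.map (Set.rangeFactorization (F.typeOf V S))
  R i t s := (∀ A, box i A ∈ t.1 → box i A ∈ s.1) ∧
    (t.1 ∈ F.stableTypes V S → (i = 0 → s = t) ∧ (i = 1 → s.1 ∈ F.stableTypes V S))

/-- The valuation on the filtration: a letter is true at the types that contain it. -/
def filtrationValuation (p : ℕ) : Set (F.filtration V S).World :=
  {t : Set.range (F.typeOf V S) | var p ∈ t.1}

variable {F V S}

/-- The point of the filtration that corresponds to a point of `F`. -/
def toFiltration (x : F.World) : (F.filtration V S).World :=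
  Set.rangeFactorization (F.typeOf V S) x

theorem exists_toFiltration_eq (t : (F.filtration V S).World) :
    ∃ x, toFiltration x = t ∧ (t.1 ∈ F.stableTypes V S → F.IsStable V S x) := by
  obtain ⟨t, x, rfl⟩ := t
  by_cases ht : F.typeOf V S x ∈ F.stableTypes V S
  · obtain ⟨y, hy, hyx⟩ := ht
    exact ⟨y, Subtype.ext hyx, fun _ => hy⟩
  · exact ⟨x, rfl, fun h => absurd h ht⟩

namespace IsLModel

variable (hM : F.IsLModel V)
include hM

theorem typeOf_eq_of_rel_zero {x y : F.World} (hx : F.IsStable V S x) (hxy : F.R 0 x y) :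
    F.typeOf V S y = F.typeOf V S x :=
  Set.ext fun A => and_congr_right fun hA => hx A hA x (hM.refl 1 x) y hxy

theorem filtration_rel {i : Fin 2} {x y : F.World} (hxy : F.R i x y)
    (hx : F.typeOf V S x ∈ F.stableTypes V S → F.IsStable V S x) :
    (F.filtration V S).R i (toFiltration x) (toFiltration y) := by
  refine ⟨fun A hA => ⟨hA.1, fun z hyz => hA.2 z (hM.trans i x y z hxy hyz)⟩,
    fun hstable => ⟨?_, ?_⟩⟩
  · rintro rfl
    exact Subtype.ext (hM.typeOf_eq_of_rel_zero (hx hstable) hxy)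
  · rintro rfl
    exact ⟨y, hM.isStable_of_rel_one (hx hstable) hxy, rfl⟩

theorem isLFrame_filtration (hS : S.Finite) : (F.filtration V S).IsLFrame where
  refl i t := ⟨fun _ => id, fun ht => ⟨fun _ => rfl, fun _ => ht⟩⟩
  trans i t s r hts hsr := by
    refine ⟨fun A hA => hsr.1 A (hts.1 A hA), fun ht => ⟨fun hi => ?_, fun hi => ?_⟩⟩
    · obtain rfl := (hts.2 ht).1 hi
      exact (hsr.2 ht).1 hi
    · exact (hsr.2 ((hts.2 ht).2 hi)).2 hi
  exists_final t := by
    obtain ⟨x, rfl, hx⟩ := exists_toFiltration_eq t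
    obtain ⟨y, hxy, hy⟩ := hM.exists_isStable hS x
    refine ⟨toFiltration y, hM.filtration_rel hxy hx, fun z hyz w hzw => ?_⟩
    have hz : z.1 ∈ F.stableTypes V S := (hyz.2 ⟨y, hy, rfl⟩).2 rfl
    exact (hzw.2 hz).1 rfl

theorem sat_filtration_iff (hS : IsSubformulaClosed S) {A : Formula 2} (hA : A ∈ S)
    {t : (F.filtration V S).World} :
    (F.filtration V S).Sat (F.filtrationValuation V S) t A ↔ A ∈ t.1 := by
  induction A generalizing t with
  | var p => rfl
  | bot =>
    obtain ⟨x, rfl, -⟩ := exists_toFiltration_eq t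
    exact iff_of_false id fun h => h.2
  | imp A B ihA ihB =>
    refine (imp_congr (ihA (hS.imp_left hA)) (ihB (hS.imp_right hA))).trans ?_
    obtain ⟨x, rfl, -⟩ := exists_toFiltration_eq t
    exact ⟨fun h => ⟨hA, fun hAx => (h ⟨hS.imp_left hA, hAx⟩).2⟩,
      fun h hAx => ⟨hS.imp_right hA, h.2 hAx.2⟩⟩
  | box i A ih =>
    have hA' := hS.of_box hA
    refine (forall₂_congr fun s _ => ih hA').trans ⟨fun h => ?_, fun h s hts => ?_⟩
    · obtain ⟨x, rfl, hx⟩ := exists_toFiltration_eq t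
      exact ⟨hA, fun y hxy => (h (toFiltration y) (hM.filtration_rel hxy hx)).2⟩
    · have hs := hts.1 A h
      obtain ⟨y, rfl, -⟩ := exists_toFiltration_eq s
      exact ⟨hA', hs.2 y (hM.refl i y)⟩

end IsLModel

theorem finite_filtration (hS : S.Finite) : Finite (F.filtration V S).World :=
  (hS.finite_subsets.subset (Set.range_subset_iff.2 fun _ => Set.sep_subset _ _)).to_subtype

theorem card_filtration_le (hS : S.Finite) :
    Nat.card (F.filtration V S).World ≤ 2 ^ S.ncard := by
  rw [← Set.ncard_powerset S hS]
  exact Set.ncard_le_ncard (Set.range_subset_iff.2 fun _ => Set.sep_subset _ _) hS.finite_subsets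

end KripkeFrame

end Filtration

section Codes

variable {N : ℕ}

theorem code_lt_code_imp_left (A B : Formula N) : A.code < (imp A B).code := by
  have := Nat.left_le_pair A.code B.code
  simp only [code]
  omega

theorem code_lt_code_imp_right (A B : Formula N) : B.code < (imp A B).code := by
  have := Nat.right_le_pair A.code B.code
  simp only [code]
  omega

theorem code_lt_code_box (i : Fin N) (A : Formula N) : A.code < (box i A).code := by
  have := Nat.le_mul_of_pos_left A.code i.pos
  simp only [code]
  omega

theorem code_surjective [NeZero N] : Function.Surjective (code : Formula N → ℕ) := by
  intro n
  induction n using Nat.strong_induction_on with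
  | _ n ih =>
    obtain rfl | ⟨k, rfl | rfl | rfl⟩ :
        n = 0 ∨ ∃ k, n = 3 * k + 1 ∨ n = 3 * k + 2 ∨ n = 3 * k + 3 := by
      by_cases h : n = 0
      · exact Or.inl h
      · exact Or.inr ⟨(n - 1) / 3, by omega⟩
    · exact ⟨bot, rfl⟩
    · exact ⟨var k, rfl⟩
    · obtain ⟨A, hA⟩ := ih k.unpair.1 (by have := Nat.unpair_left_le k; omega)
      obtain ⟨B, hB⟩ := ih k.unpair.2 (by have := Nat.unpair_right_le k; omega)
      exact ⟨imp A B, by rw [code, hA, hB, Nat.pair_unpair]⟩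
    · obtain ⟨A, hA⟩ := ih (k / N) (by have := Nat.div_le_self k N; omega)
      refine ⟨box ⟨k % N, Nat.mod_lt k (NeZero.pos N)⟩ A, ?_⟩
      simp only [code, hA, Nat.div_add_mod]

theorem isSubformulaClosed_setOf_code_le (n : ℕ) :
    IsSubformulaClosed {A : Formula N | A.code ≤ n} where
  imp_left {A B} h := (code_lt_code_imp_left A B).le.trans h
  imp_right {A B} h := (code_lt_code_imp_right A B).le.trans h
  of_box {i A} h := (code_lt_code_box i A).le.trans h

theorem finite_setOf_code_le (n : ℕ) : {A : Formula N | A.code ≤ n}.Finite :=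
  (Set.finite_Iic n).preimage code_injective.injOn

theorem ncard_setOf_code_le (n : ℕ) : {A : Formula N | A.code ≤ n}.ncard ≤ n + 1 := by
  calc {A : Formula N | A.code ≤ n}.ncard
      ≤ (Set.Iic n).ncard :=
        Set.ncard_le_ncard_of_injOn code (fun _ hA => hA) code_injective.injOn (Set.finite_Iic n)
    _ = n + 1 := by rw [Set.ncard_eq_toFinset_card', Set.toFinset_Iic, Nat.card_Iic]

end Codes

section FiniteModelProperty

theorem exists_finite_isLFrame_not_valid {A : Formula 2} (hA : A ∉ logicL) :
    ∃ F : KripkeFrame.{0} 2, F.IsLFrame ∧ Finite F.World ∧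
      Nat.card F.World ≤ 2 ^ (A.code + 1) ∧ ¬ F.Valid A := by
  obtain ⟨F, V, x, hM, hx⟩ := exists_isLModel_not_sat hA
  have hfin := finite_setOf_code_le (N := 2) A.code
  refine ⟨F.filtration V {B | B.code ≤ A.code}, hM.isLFrame_filtration hfin,
    KripkeFrame.finite_filtration hfin, (KripkeFrame.card_filtration_le hfin).trans
      (Nat.pow_le_pow_right two_pos (ncard_setOf_code_le A.code)), fun hvalid => hx ?_⟩
  have hmem : A ∈ F.typeOf V {B | B.code ≤ A.code} x :=
    (hM.sat_filtration_iff (isSubformulaClosed_setOf_code_le A.code) (le_refl A.code)).1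
      (hvalid _ (KripkeFrame.toFiltration x))
  exact hmem.2

theorem hasFiniteModelProperty_logicL : HasFiniteModelProperty logicL := by
  refine ⟨{F | F.IsLFrame ∧ Finite F.World}, fun F hF => hF.2,
    Set.Subset.antisymm (fun A hA F hF => hF.1.logicL_subset_valid hA) fun A hA => ?_⟩
  by_contra hn
  obtain ⟨F, hF, hfin, -, hv⟩ := exists_finite_isLFrame_not_valid hn
  exact hv (hA F ⟨hF, hfin⟩)

end FiniteModelProperty

section FrameIsomorphisms

variable {N : ℕ}

/-- Isomorphisms of Kripke frames. -/
structure KripkeFrame.Iso (F : KripkeFrame.{u} N) (G : KripkeFrame.{v} N) where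
  toEquiv : F.World ≃ G.World
  rel_iff : ∀ i x y, G.R i (toEquiv x) (toEquiv y) ↔ F.R i x y

variable {F : KripkeFrame.{u} N} {G : KripkeFrame.{v} N}

theorem KripkeFrame.Iso.sat_iff (e : F.Iso G) (V : ℕ → Set G.World) (A : Formula N)
    (x : F.World) :
    G.Sat V (e.toEquiv x) A ↔ F.Sat (fun p => e.toEquiv ⁻¹' V p) x A := by
  induction A generalizing x with
  | var p => rfl
  | bot => rfl
  | imp A B ihA ihB => exact imp_congr (ihA x) (ihB x)
  | box i A ih =>
    exact e.toEquiv.forall_congr_right.symm.trans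
      (forall_congr' fun y => imp_congr (e.rel_iff i x y) (ih y))

theorem KripkeFrame.Iso.valid_of_valid (e : F.Iso G) {A : Formula N} (hA : G.Valid A) :
    F.Valid A := fun V x => by
  have := (e.sat_iff (fun p => e.toEquiv.symm ⁻¹' V p) A x).1 (hA _ _)
  simpa only [Equiv.preimage_symm_preimage] using this

theorem KripkeFrame.IsLFrame.of_iso {F : KripkeFrame.{u} 2} {G : KripkeFrame.{v} 2}
    (e : F.Iso G) (hF : F.IsLFrame) : G.IsLFrame := by
  have hR (i : Fin 2) (x y : G.World) :
      G.R i x y ↔ F.R i (e.toEquiv.symm x) (e.toEquiv.symm y) := by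
    rw [← e.rel_iff, e.toEquiv.apply_symm_apply, e.toEquiv.apply_symm_apply]
  refine ⟨fun i x => (hR i x x).2 (hF.refl i _), fun i x y z hxy hyz => ?_, fun x => ?_⟩
  · exact (hR i x z).2 (hF.trans i _ _ _ ((hR i x y).1 hxy) ((hR i y z).1 hyz))
  · obtain ⟨y, hxy, hfinal⟩ := hF.exists_final (e.toEquiv.symm x)
    refine ⟨e.toEquiv y, (hR 0 _ _).2 (by simpa using hxy), fun z hyz w hzw => ?_⟩
    refine e.toEquiv.symm.injective (hfinal _ ?_ _ ((hR 0 z w).1 hzw))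
    simpa using (hR 1 _ z).1 hyz

end FrameIsomorphisms

section CodedFrames

theorem exists_testBit_iff (m : ℕ) (P : ℕ → Prop) :
    ∃ b < 2 ^ m, ∀ j < m, (b.testBit j ↔ P j) := by
  classical
  refine ⟨Nat.ofBits fun j : Fin m => decide (P j), Nat.ofBits_lt_two_pow _, fun j hj => ?_⟩
  rw [Nat.testBit_ofBits_lt _ j hj, decide_eq_true_iff]

theorem pair_lt_pair {a b m n : ℕ} (ha : a < m) (hb : b < n) : Nat.pair a b < Nat.pair m n :=
  (Nat.pair_lt_pair_left b ha).trans (Nat.pair_lt_pair_right m hb)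

/-- The relations coded by the binary digits of `r`. -/
def CodedRel (r i x y : ℕ) : Prop := r.testBit (Nat.pair i (Nat.pair x y))

/-- The frame on `k + 1` points whose relations are coded by `r`. -/
def codedFrame (N k r : ℕ) : KripkeFrame.{0} N where
  World := Fin (k + 1)
  nonempty := inferInstance
  R i x y := CodedRel r i x y

variable {N : ℕ}

theorem KripkeFrame.exists_iso_codedFrame (F : KripkeFrame.{u} N) [Finite F.World] :
    ∃ k r, k + 1 = Nat.card F.World ∧ r < 2 ^ Nat.pair N (Nat.pair (k + 1) (k + 1)) ∧
      Nonempty (F.Iso (codedFrame N k r)) := by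
  have := F.nonempty
  obtain ⟨k, hk⟩ := Nat.exists_eq_add_one.2 (Nat.card_pos (α := F.World))
  let e : F.World ≃ Fin (k + 1) := Finite.equivFinOfCardEq hk
  obtain ⟨r, hr, hrel⟩ := exists_testBit_iff (Nat.pair N (Nat.pair (k + 1) (k + 1))) fun j =>
    ∃ i x y, j = Nat.pair (i : Fin N) (Nat.pair (e x) (e y)) ∧ F.R i x y
  refine ⟨k, r, hk.symm, hr, ⟨e, fun i x y => ?_⟩⟩
  refine (hrel _ (pair_lt_pair i.2 (pair_lt_pair (e x).2 (e y).2))).trans ⟨?_, fun h =>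
    ⟨i, x, y, rfl, h⟩⟩
  rintro ⟨i', x', y', heq, h⟩
  simp only [Nat.pair_eq_pair, Fin.val_inj, e.apply_eq_iff_eq] at heq
  obtain ⟨rfl, rfl, rfl⟩ := heq
  exact h

theorem isLFrame_codedFrame_iff {k r : ℕ} : (codedFrame 2 k r).IsLFrame ↔
    (∀ i < 2, ∀ x < k + 1, CodedRel r i x x) ∧
    (∀ i < 2, ∀ x < k + 1, ∀ y < k + 1, ∀ z < k + 1,
      CodedRel r i x y → CodedRel r i y z → CodedRel r i x z) ∧
    ∀ x < k + 1, ∃ y < k + 1, CodedRel r 0 x y ∧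
      ∀ z < k + 1, CodedRel r 1 y z → ∀ w < k + 1, CodedRel r 0 z w → w = z := by
  constructor
  · intro h
    refine ⟨fun i hi x hx => h.refl ⟨i, hi⟩ ⟨x, hx⟩,
      fun i hi x hx y hy z hz => h.trans ⟨i, hi⟩ ⟨x, hx⟩ ⟨y, hy⟩ ⟨z, hz⟩, fun x hx => ?_⟩
    obtain ⟨y, hxy, hfinal⟩ := h.exists_final ⟨x, hx⟩
    exact ⟨y.1, y.2, hxy, fun z hz hyz w hw hzw =>
      congrArg Fin.val (hfinal ⟨z, hz⟩ hyz ⟨w, hw⟩ hzw)⟩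
  · rintro ⟨refl, trans, exists_final⟩
    refine ⟨fun i x => refl i.1 i.2 x.1 x.2,
      fun i x y z => trans i.1 i.2 x.1 x.2 y.1 y.2 z.1 z.2, fun x => ?_⟩
    obtain ⟨y, hy, hxy, hfinal⟩ := exists_final x.1 x.2
    exact ⟨⟨y, hy⟩, hxy, fun z hyz w hzw => Fin.ext (hfinal z.1 z.2 hyz w.1 w.2 hzw)⟩

/-- The truth value that the table `T` assigns at the point `x` to the formula with code `c`. -/
def CodedSat (T x c : ℕ) : Prop := T.testBit (Nat.pair c x)

/-- `T` obeys the truth conditions in the frame `codedFrame N k r` for all formulas with code at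
most `n`. -/
def IsTruthTable (N n k r T : ℕ) : Prop :=
  (∀ x < k + 1, ¬ CodedSat T x 0) ∧
  (∀ a < n + 1, ∀ b < n + 1, 3 * Nat.pair a b + 2 < n + 1 → ∀ x < k + 1,
    (CodedSat T x (3 * Nat.pair a b + 2) ↔ (CodedSat T x a → CodedSat T x b))) ∧
  ∀ i < N, ∀ a < n + 1, 3 * (N * a + i) + 3 < n + 1 → ∀ x < k + 1,
    (CodedSat T x (3 * (N * a + i) + 3) ↔ ∀ y < k + 1, CodedRel r i x y → CodedSat T y a)

variable {n k r : ℕ}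

theorem IsTruthTable.sat_iff {T : ℕ} (hT : IsTruthTable N n k r T) {A : Formula N}
    (hA : A.code < n + 1) (x : Fin (k + 1)) :
    (codedFrame N k r).Sat (fun p => {y : Fin (k + 1) | CodedSat T y (3 * p + 1)}) x A ↔
      CodedSat T x A.code := by
  obtain ⟨hbot, himp, hbox⟩ := hT
  induction A generalizing x with
  | var p => rfl
  | bot => exact iff_of_false id (hbot x x.2)
  | imp A B ihA ihB =>
    have hA' := (code_lt_code_imp_left A B).trans hA
    have hB' := (code_lt_code_imp_right A B).trans hA
    exact (imp_congr (ihA hA' x) (ihB hB' x)).trans (himp _ hA' _ hB' hA x x.2).symm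
  | box i A ih =>
    have hA' := (code_lt_code_box i A).trans hA
    exact (forall₂_congr fun y _ => ih hA' y).trans
      (Fin.forall_iff.trans (hbox i i.2 _ hA' hA x x.2).symm)

theorem exists_codedSat_iff (V : ℕ → Set (codedFrame N k r).World) (n : ℕ) :
    ∃ T < 2 ^ Nat.pair (n + 1) (k + 1), ∀ (A : Formula N) (x : Fin (k + 1)), A.code < n + 1 →
      (CodedSat T x A.code ↔ (codedFrame N k r).Sat V x A) := by
  obtain ⟨T, hT, hsat⟩ := exists_testBit_iff (Nat.pair (n + 1) (k + 1)) fun j =>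
    ∃ (A : Formula N) (x : Fin (k + 1)), j = Nat.pair A.code x ∧ (codedFrame N k r).Sat V x A
  refine ⟨T, hT, fun A x hA => (hsat _ (pair_lt_pair hA x.2)).trans
    ⟨?_, fun h => ⟨A, x, rfl, h⟩⟩⟩
  rintro ⟨A', x', heq, h⟩
  simp only [Nat.pair_eq_pair, Fin.val_inj, code_injective.eq_iff] at heq
  obtain ⟨rfl, rfl⟩ := heq
  exact h

theorem exists_isTruthTable [NeZero N] (V : ℕ → Set (codedFrame N k r).World) (n : ℕ) :
    ∃ T < 2 ^ Nat.pair (n + 1) (k + 1), IsTruthTable N n k r T ∧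
      ∀ (A : Formula N) (x : Fin (k + 1)), A.code < n + 1 →
        (CodedSat T x A.code ↔ (codedFrame N k r).Sat V x A) := by
  obtain ⟨T, hT, hsat⟩ := exists_codedSat_iff V n
  refine ⟨T, hT, ⟨fun x hx => ?_, fun a ha b hb hab x hx => ?_, fun i hi a ha hia x hx => ?_⟩, hsat⟩
  · exact (hsat bot ⟨x, hx⟩ n.succ_pos).not.2 id
  · obtain ⟨A, rfl⟩ := code_surjective (N := N) a
    obtain ⟨B, rfl⟩ := code_surjective (N := N) b
    exact (hsat (imp A B) ⟨x, hx⟩ hab).trans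
      (imp_congr (hsat A ⟨x, hx⟩ ha) (hsat B ⟨x, hx⟩ hb)).symm
  · obtain ⟨A, rfl⟩ := code_surjective (N := N) a
    exact (hsat (box ⟨i, hi⟩ A) ⟨x, hx⟩ hia).trans
      ⟨fun h y hy hxy => (hsat A ⟨y, hy⟩ ha).2 (h ⟨y, hy⟩ hxy),
        fun h y hxy => (hsat A y ha).1 (h y.1 y.2 hxy)⟩

/-- Some truth table on `codedFrame N k r` refutes the formula with code `n`. -/
def CodedRefutes (N k r n : ℕ) : Prop :=
  ∃ T < 2 ^ Nat.pair (n + 1) (k + 1), IsTruthTable N n k r T ∧ ∃ x < k + 1, ¬ CodedSat T x n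

theorem codedRefutes_iff [NeZero N] {A : Formula N} :
    CodedRefutes N k r A.code ↔ ¬ (codedFrame N k r).Valid A := by
  constructor
  · rintro ⟨T, -, hT, x, hx, hAx⟩ hvalid
    exact hAx ((hT.sat_iff A.code.lt_succ_self ⟨x, hx⟩).1 (hvalid _ _))
  · intro h
    simp only [KripkeFrame.Valid, not_forall] at h
    obtain ⟨V, x, hAx⟩ := h
    obtain ⟨T, hTlt, hT, hsat⟩ := exists_isTruthTable V A.code
    exact ⟨T, hTlt, hT, x.1, x.2, (hsat A x A.code.lt_succ_self).not.2 hAx⟩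

end CodedFrames

section Decidability

variable {α : Type*} [Primcodable α]

theorem primrec_add {f g : α → ℕ} (hf : Primrec f) (hg : Primrec g) :
    Primrec fun a => f a + g a :=
  Primrec.nat_add.comp hf hg

theorem primrec_mul {f g : α → ℕ} (hf : Primrec f) (hg : Primrec g) :
    Primrec fun a => f a * g a :=
  Primrec.nat_mul.comp hf hg

theorem primrec_pow {f g : α → ℕ} (hf : Primrec f) (hg : Primrec g) :
    Primrec fun a => f a ^ g a :=
  (Primrec₂.unpaired'.1 Nat.Primrec.pow).comp hf hg

theorem primrec_pair {f g : α → ℕ} (hf : Primrec f) (hg : Primrec g) :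
    Primrec fun a => Nat.pair (f a) (g a) :=
  Primrec₂.natPair.comp hf hg

theorem primrecPred_eq {f g : α → ℕ} (hf : Primrec f) (hg : Primrec g) :
    PrimrecPred fun a => f a = g a :=
  Primrec.eq.comp hf hg

theorem primrecPred_lt {f g : α → ℕ} (hf : Primrec f) (hg : Primrec g) :
    PrimrecPred fun a => f a < g a :=
  Primrec.nat_lt.comp hf hg

theorem primrecPred_testBit {f g : α → ℕ} (hf : Primrec f) (hg : Primrec g) :
    PrimrecPred fun a => (f a).testBit (g a) = true := by
  have h : PrimrecPred fun a => f a / 2 ^ g a % 2 = 1 :=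
    primrecPred_eq (Primrec.nat_mod.comp (Primrec.nat_div.comp hf (primrec_pow (.const 2) hg))
      (.const 2)) (.const 1)
  exact h.of_eq fun a => by rw [Nat.testBit_eq_decide_div_mod_eq, decide_eq_true_iff]

theorem primrecPred_imp {p q : α → Prop} (hp : PrimrecPred p) (hq : PrimrecPred q) :
    PrimrecPred fun a => p a → q a :=
  (hp.not.or hq).of_eq fun _ => imp_iff_not_or.symm

theorem primrecPred_iff {p q : α → Prop} (hp : PrimrecPred p) (hq : PrimrecPred q) :
    PrimrecPred fun a => p a ↔ q a :=
  ((primrecPred_imp hp hq).and (primrecPred_imp hq hp)).of_eq fun _ => iff_def.symm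

theorem primrecPred_forall_lt {p : α → ℕ → Prop} {f : α → ℕ} (hf : Primrec f)
    (hp : PrimrecPred fun q : α × ℕ => p q.1 q.2) : PrimrecPred fun a => ∀ x < f a, p a x := by
  have h : PrimrecRel fun (x : ℕ) (a : α) => p a x := hp.comp (Primrec.snd.pair Primrec.fst)
  exact (h.forall_mem_list.comp (Primrec.list_range.comp hf) .id).of_eq (by simp)

theorem primrecPred_exists_lt {p : α → ℕ → Prop} {f : α → ℕ} (hf : Primrec f)
    (hp : PrimrecPred fun q : α × ℕ => p q.1 q.2) : PrimrecPred fun a => ∃ x < f a, p a x := by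
  have h : PrimrecRel fun (x : ℕ) (a : α) => p a x := hp.comp (Primrec.snd.pair Primrec.fst)
  exact (h.exists_mem_list.comp (Primrec.list_range.comp hf) .id).of_eq (by simp)

-- Registering the closure properties with `fun_prop` lets it read off primitive recursiveness from
-- the shape of a definition by bounded quantifiers.
attribute [local fun_prop] Primrec PrimrecPred Primrec.id Primrec.const Primrec.comp Primrec.pair
  Primrec.fst Primrec.snd PrimrecPred.not PrimrecPred.and primrec_add primrec_mul primrec_pow
  primrec_pair primrecPred_eq primrecPred_lt primrecPred_testBit primrecPred_imp primrecPred_iff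
  primrecPred_forall_lt primrecPred_exists_lt

theorem primrecPred_codedRefutes (N : ℕ) {k r n : α → ℕ} (hk : Primrec k) (hr : Primrec r)
    (hn : Primrec n) : PrimrecPred fun a => CodedRefutes N (k a) (r a) (n a) := by
  unfold CodedRefutes IsTruthTable CodedSat CodedRel
  fun_prop

attribute [local fun_prop] primrecPred_codedRefutes

theorem isDecidable_of_bounded_frames {N : ℕ} [NeZero N] {L : Set (Formula N)}
    {C : Set (KripkeFrame.{0} N)} (hiso : ∀ F G, Nonempty (F.Iso G) → F ∈ C → G ∈ C)
    (hC : PrimrecPred fun q : ℕ × ℕ => codedFrame N q.1 q.2 ∈ C) (hsound : L ⊆ logicOf C)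
    {b : ℕ → ℕ} (hb : Primrec b)
    (hcomplete : ∀ A ∉ L, ∃ F ∈ C, Finite F.World ∧ Nat.card F.World ≤ b A.code ∧ ¬ F.Valid A) :
    IsDecidable L := by
  let Refutable (n : ℕ) : Prop := ∃ k < b n, ∃ r < 2 ^ Nat.pair N (Nat.pair (k + 1) (k + 1)),
    codedFrame N k r ∈ C ∧ CodedRefutes N k r n
  have hprim : PrimrecPred Refutable := by
    have hC' : PrimrecPred fun q : (ℕ × ℕ) × ℕ => codedFrame N q.1.2 q.2 ∈ C :=
      hC.comp (by fun_prop : Primrec fun q : (ℕ × ℕ) × ℕ => (q.1.2, q.2))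
    fun_prop
  have hrefutable (A : Formula N) : Refutable A.code ↔ A ∉ L := by
    refine ⟨fun ⟨k, _, r, _, hF, hA⟩ hAL => codedRefutes_iff.1 hA (hsound hAL _ hF), fun hA => ?_⟩
    obtain ⟨F, hF, hfin, hcard, hvalid⟩ := hcomplete A hA
    obtain ⟨k, r, hk, hr, ⟨e⟩⟩ := F.exists_iso_codedFrame
    exact ⟨k, by omega, r, hr, hiso _ _ ⟨e⟩ hF,
      codedRefutes_iff.2 fun h => hvalid (e.valid_of_valid h)⟩
  refine (hprim.not.of_eq fun n => ?_).computablePred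
  obtain ⟨A, rfl⟩ := code_surjective (N := N) n
  simp only [hrefutable, not_not, code_injective.eq_iff, exists_eq_right]

theorem primrecPred_isLFrame_codedFrame :
    PrimrecPred fun q : ℕ × ℕ => (codedFrame 2 q.1 q.2).IsLFrame := by
  simp only [isLFrame_codedFrame_iff, CodedRel]
  fun_prop

theorem isDecidable_logicL : IsDecidable logicL :=
  isDecidable_of_bounded_frames (C := {F | F.IsLFrame}) (fun _ _ ⟨e⟩ hF => .of_iso e hF)
    primrecPred_isLFrame_codedFrame (fun _ hA _ hF => hF.logicL_subset_valid hA)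
    (by fun_prop : Primrec fun c => 2 ^ (c + 1)) fun _ => exists_finite_isLFrame_not_valid

end Decidability

end Modal

theorem mainTheorem2 :
    Modal.IsFinitelyAxiomatizable Modal.logicL ∧
      Modal.HasFiniteModelProperty Modal.logicL ∧
      Modal.IsDecidable Modal.logicL :=
  ⟨Modal.isFinitelyAxiomatizable_logicL, Modal.hasFiniteModelProperty_logicL,
    Modal.isDecidable_logicL⟩
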